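/- Let $A$ be a finite totally ordered alphabet and $A^*$ the free monoid on $A$. A \emph{column} is a subset $\gamma$ of $A$, identified with the word that is the decreasing product of its elements. For a letter $x$ and a column $\gamma$, let $x\cdot\gamma=(\gamma\setminus\{y\})\cup\{x\}$, where $y$ is the smallest element of $\gamma$ with $y\ge x$, and $x\cdot\gamma=\gamma\cup\{x\}$ if there is no such $y$. This defines a left action of $A^*$ on the set of columns. The stylic monoid $Styl(A)$ is the monoid of endofunctions of the set of columns given by the words, $\equiv_{styl}$ is the corresponding congruence on $A^*$, and $\mathbb Z Styl(A)$ is the monoid algebra; a letter $a$ also denotes its image in it. For each column $\gamma$ put $$e_\gamma=\prod^{\nearrow}_{a\notin\gamma}(1-a)\prod^{\searrow}_{a\in\gamma}a\in\mathbb Z Styl(A),$$ where the first product is in increasing and the second in decreasing order of letters. Let $Q(A)$ be the quiver whose vertices are the columns, with an edge $\gamma\xrightarrow{c}\delta$ labelled by the letter $c$ whenever $c\notin\gamma$, some element of $\gamma$ is $\le c$, and $\delta=(\gamma\setminus\{b\})\cup\{c\}$, where $b$ is the largest element of $\gamma$ with $b\le c$. The label of a path is the product of the labels of its edges. Let $\mathbb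 ZQ(A)$ be the path algebra of $Q(A)$, the free $\mathbb Z$-module with basis the set of paths (including an empty path at each vertex), and let $\varphi:\mathbb ZQ(A)\to\mathbb ZStyl(A)$ be the $\mathbb Z$-linear map that sends the empty path at $\gamma$ to $e_\gamma$ and a path $\gamma_0\xrightarrow{c_1}\gamma_1\xrightarrow{c_2}\cdots\xrightarrow{c_l}\gamma_l$ to $e_{\gamma_0}c_1e_{\gamma_1}c_2\cdots c_le_{\gamma_l}$. Then the kernel of $\varphi$ is spanned over $\mathbb Z$ by the elements which are differences of two paths in $Q(A)$ starting from the same vertex $\gamma$ and having labels $u,v$ satisfying $\gamma u\equiv_{styl}\gamma v$. -/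

import Mathlib

noncomputable section

/-- Schensted column insertion of the letter `x` into the column `γ` (a column is a finite subset
of the alphabet): `x` replaces the smallest `y ∈ γ` with `y ≥ x`; if there is none, `x` is added. -/
def colInsert {A : Type*} [LinearOrder A] (x : A) (γ : Finset A) : Finset A :=
  if h : (γ.filter (fun y => x ≤ y)).Nonempty then
    insert x (γ.erase ((γ.filter (fun y => x ≤ y)).min' h))
  else insert x γ

/-- The left action of words on columns, as a monoid homomorphism into the monoid of endofunctions
of the set of columns (whose product is composition). -/
def leftAction (A : Type*) [LinearOrder A] : FreeMonoid A →* Function.End (Finset A) :=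
  FreeMonoid.lift (fun x : A => (colInsert x : Function.End (Finset A)))

/-- The stylic monoid: all the endofunctions of the set of columns that are given by words. -/
abbrev Styl (A : Type*) [LinearOrder A] : Type _ := MonoidHom.mrange (leftAction A)

/-- The canonical homomorphism from words to the stylic monoid. -/
def stylMk (A : Type*) [LinearOrder A] : FreeMonoid A →* Styl A := (leftAction A).mrangeRestrict

/-- The stylic congruence. -/
def StylEquiv {A : Type*} [LinearOrder A] (u v : FreeMonoid A) : Prop := stylMk A u = stylMk A v

/-- The stylic algebra over the integers. -/
abbrev StylAlgebra (A : Type*) [LinearOrder A] : Type _ := MonoidAlgebra ℤ (Styl A)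

/-- The image of a letter in the stylic algebra. -/
def stylLetter {A : Type*} [LinearOrder A] (a : A) : StylAlgebra A :=
  MonoidAlgebra.of ℤ (Styl A) (stylMk A (FreeMonoid.of a))

/-- A column as a word: the decreasing product of its elements. -/
def colWord {A : Type*} [LinearOrder A] (γ : Finset A) : FreeMonoid A :=
  FreeMonoid.ofList (γ.sort (fun a b => b ≤ a))

/-- The idempotent `e_γ`: the product of the `1 - a`, `a ∉ γ`, in increasing order, times the
product of the `a ∈ γ`, in decreasing order. -/
def colIdem {A : Type*} [LinearOrder A] [Fintype A] (γ : Finset A) : StylAlgebra A :=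
  ((γᶜ.sort (fun a b => a ≤ b)).map (fun a => 1 - stylLetter a)).prod *
    ((γ.sort (fun a b => b ≤ a)).map (fun a => stylLetter a)).prod

/-- The right action of a letter on a column: `c` replaces the largest `x ∈ γ` with `x ≤ c`;
if there is none, `c` is added. -/
def colRight {A : Type*} [LinearOrder A] (γ : Finset A) (c : A) : Finset A :=
  if h : (γ.filter (fun x => x ≤ c)).Nonempty then
    insert c (γ.erase ((γ.filter (fun x => x ≤ c)).max' h))
  else insert c γ

/-- The right action of `c` on `γ` is frank: `c ≥ min γ` and `c ∉ γ`
(never the case for the empty column). -/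
def Frank {A : Type*} [LinearOrder A] (γ : Finset A) (c : A) : Prop :=
  (∃ x ∈ γ, x ≤ c) ∧ c ∉ γ

/-- The vertices of the quiver `Q(A)`: one for each column. (A structure of its own, so that the
arrows are not confused with those of the inclusion order on finite sets.) -/
@[ext] structure QVertex (A : Type*) where
  /-- the column -/
  col : Finset A

/-- An edge of `Q(A)`, with its label. -/
@[ext] structure QEdge {A : Type*} [LinearOrder A] (γ δ : QVertex A) where
  /-- the label of the edge -/
  letter : A
  frank : Frank γ.col letter
  target : colRight γ.col letter = δ.col

/-- The quiver `Q(A)`. -/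
instance stylQuiver (A : Type*) [LinearOrder A] : Quiver (QVertex A) where
  Hom γ δ := QEdge γ δ

/-- The label of an edge of `Q(A)`. -/
def edgeLetter {A : Type*} [LinearOrder A] {γ δ : QVertex A} (e : γ ⟶ δ) : A := QEdge.letter e

/-- The label of a path: the product of the labels of its edges. -/
def pathLabel {A : Type*} [LinearOrder A] {γ : QVertex A} :
    {δ : QVertex A} → Quiver.Path γ δ → FreeMonoid A
  | _, .nil => 1
  | _, .cons p e => pathLabel p * FreeMonoid.of (edgeLetter e)

/-- The element `e_{γ₀} c₁ e_{γ₁} c₂ ⋯ c_l e_{γ_l}` of the stylic algebra attached to the path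
`γ₀ → γ₁ → ⋯ → γ_l` with edge labels `c₁, …, c_l`. -/
def pathImage {A : Type*} [LinearOrder A] [Fintype A] {γ : QVertex A} :
    {δ : QVertex A} → Quiver.Path γ δ → StylAlgebra A
  | _, .nil => colIdem γ.col
  | δ, .cons p e => pathImage p * stylLetter (edgeLetter e) * colIdem δ.col

/-- The set of all the paths of `Q(A)`, including an empty path at each vertex. -/
abbrev QPath (A : Type*) [LinearOrder A] : Type _ :=
  Σ γ : QVertex A, Σ δ : QVertex A, Quiver.Path γ δ

/-- The path algebra `ℤQ(A)` as a `ℤ`-module: it is free on the set of paths. -/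
abbrev PathAlgebra (A : Type*) [LinearOrder A] : Type _ := QPath A →₀ ℤ

/-- The basis element of `ℤQ(A)` given by a path. -/
def pathElt {A : Type*} [LinearOrder A] {γ δ : QVertex A} (p : Quiver.Path γ δ) : PathAlgebra A :=
  Finsupp.single ⟨γ, δ, p⟩ 1

/-- The quiver map `φ : ℤQ(A) → ℤStyl(A)`. -/
def quiverMap (A : Type*) [LinearOrder A] [Fintype A] : PathAlgebra A →ₗ[ℤ] StylAlgebra A :=
  Finsupp.linearCombination ℤ (fun p : QPath A => pathImage p.2.2)

end

noncomputable section

/-! ### Left insertion and right action on columns -/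

section Columns

variable {A : Type*} [LinearOrder A]

/-! The image of a path depends only on the class `m` of `γu`, with `γ` its start and `u` its label,
and distinct classes have linearly independent images; so the kernel is spanned by differences of
paths of equal class.

Write `P_γ` for the increasing product of the `1 - a`, `a ∉ γ`, and call the image of the empty
column under `m` its shape. `P_γ` kills every `m` whose shape has a letter outside `γ`. Hence, after
a path from `γ` to `δ`, a letter in `δ` acts trivially, a frank letter extends the path, and a
letter below `min δ` gives zero, as it makes the shape larger than `γ`. Frank moves keep the size of
the column and lower a potential. So multiplying by `P_δ` only adds paths with targets of lower
potential, and the column word `δ` kills these: the inner idempotents are absorbed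
(`pathValue_mul_colIdem`), and the path maps to `P_γ m`.

The shape of `m` is `γ`, and left insertion of missing letters raises the potential. So `P_γ m` is
`m` plus terms whose shapes have larger potential: a triangular, hence independent, family
(`linearCombination_triangularElt_eq_zero`). -/

theorem mem_colInsert {x w : A} {γ : Finset A} :
    w ∈ colInsert x γ ↔ w = x ∨ (w ∈ γ ∧ (w < x ∨ ∃ t ∈ γ, x ≤ t ∧ t < w)) := by
  unfold colInsert
  split_ifs with h
  · have h1 := Finset.min'_mem _ h
    have h2 := fun t ht => Finset.min'_le (γ.filter (fun y => x ≤ y)) t ht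
    set m := (γ.filter (fun y => x ≤ y)).min' h
    simp only [Finset.mem_filter, Finset.mem_insert, Finset.mem_erase] at *
    grind
  · simp only [Finset.not_nonempty_iff_eq_empty, Finset.filter_eq_empty_iff, not_le] at h
    simp only [Finset.mem_insert]
    grind

theorem mem_colRight {w c : A} {γ : Finset A} :
    w ∈ colRight γ c ↔ w = c ∨ (w ∈ γ ∧ (c < w ∨ ∃ t ∈ γ, t ≤ c ∧ w < t)) := by
  unfold colRight
  split_ifs with h
  · have h1 := Finset.max'_mem _ h
    have h2 := fun t ht => Finset.le_max' (γ.filter (fun y => y ≤ c)) t ht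
    set m := (γ.filter (fun y => y ≤ c)).max' h
    simp only [Finset.mem_filter, Finset.mem_insert, Finset.mem_erase] at *
    grind
  · simp only [Finset.not_nonempty_iff_eq_empty, Finset.filter_eq_empty_iff, not_le] at h
    simp only [Finset.mem_insert]
    grind

theorem colInsert_of_mem {x : A} {γ : Finset A} (h : x ∈ γ) : colInsert x γ = γ := by
  ext w; rw [mem_colInsert]; grind

/-- Insertion either adds a letter or replaces a letter by a smaller one. -/
theorem colInsert_cases (x : A) (γ : Finset A) :
    ((∀ y ∈ γ, y < x) ∧ colInsert x γ = insert x γ) ∨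
      ∃ y ∈ γ, x ≤ y ∧ (∀ t ∈ γ, x ≤ t → y ≤ t) ∧ colInsert x γ = insert x (γ.erase y) := by
  unfold colInsert
  split_ifs with h
  · right
    have h1 := Finset.min'_mem _ h
    have h2 := fun t ht => Finset.min'_le (γ.filter (fun y => x ≤ y)) t ht
    simp only [Finset.mem_filter] at h1 h2
    exact ⟨_, h1.1, h1.2, fun t ht hx => h2 t ⟨ht, hx⟩, rfl⟩
  · left
    simp only [Finset.not_nonempty_iff_eq_empty, Finset.filter_eq_empty_iff, not_le] at h
    exact ⟨fun y hy => h hy, rfl⟩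

/-- A frank letter replaces a smaller letter of the column. -/
theorem colRight_of_frank {γ : Finset A} {c : A} (h : Frank γ c) :
    ∃ b ∈ γ, b < c ∧ (∀ t ∈ γ, t ≤ c → t ≤ b) ∧ colRight γ c = insert c (γ.erase b) := by
  obtain ⟨⟨x, hx, hxc⟩, hc⟩ := h
  have h : (γ.filter (fun x => x ≤ c)).Nonempty := ⟨x, by simp [hx, hxc]⟩
  unfold colRight
  rw [dif_pos h]
  have h1 := Finset.max'_mem _ h
  have h2 := fun t ht => Finset.le_max' (γ.filter (fun x => x ≤ c)) t ht
  simp only [Finset.mem_filter] at h1 h2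
  exact ⟨_, h1.1, lt_of_le_of_ne h1.2 (fun he => hc (he ▸ h1.1)), fun t ht hx => h2 t ⟨ht, hx⟩, rfl⟩

theorem colInsert_idem (x : A) (γ : Finset A) : colInsert x (colInsert x γ) = colInsert x γ :=
  colInsert_of_mem (mem_colInsert.2 (Or.inl rfl))

theorem colInsert_mono (x : A) {γ ρ : Finset A} (h : γ ⊆ ρ) : colInsert x γ ⊆ colInsert x ρ := by
  intro w hw
  rw [mem_colInsert] at *
  have := @h
  grind

theorem card_le_card_colInsert (x : A) (γ : Finset A) : γ.card ≤ (colInsert x γ).card := by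
  rcases colInsert_cases x γ with ⟨h, e⟩ | ⟨y, hy, hxy, hm, e⟩
  · rw [e]; exact Finset.card_le_card (Finset.subset_insert _ _)
  · rw [e, Finset.card_insert_of_notMem, Finset.card_erase_add_one hy]
    intro hx
    have := hm x (Finset.mem_of_mem_erase hx) le_rfl
    have := Finset.ne_of_mem_erase hx
    order

/-- Once `y` is present, `x` replaces a letter at most `y`, while `z` acts only on letters at least
`z > y`; the two insertions do not interact. -/
theorem colInsert_knuth_left {x y z : A} (hxy : x ≤ y) (hyz : y < z) (ρ : Finset A) :
    colInsert x (colInsert z (colInsert y ρ)) = colInsert z (colInsert x (colInsert y ρ)) := by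
  have hy : y ∈ colInsert y ρ := mem_colInsert.2 (Or.inl rfl)
  generalize colInsert y ρ = σ at hy
  rcases colInsert_cases x σ with ⟨h, e⟩ | ⟨p, hp, hxp, hm, e⟩
  · exact absurd (h y hy) (not_lt.2 hxy)
  have := hm y hy hxy
  ext w
  simp only [mem_colInsert]
  grind

theorem colInsert_colInsert_of_gap {x z : A} (hxz : x ≤ z) {ρ : Finset A}
    (h : ∀ t ∈ ρ, x ≤ t → z ≤ t) : colInsert x (colInsert z ρ) = colInsert x ρ := by
  ext w
  simp only [mem_colInsert]
  grind

theorem colInsert_knuth_right {x y z : A} (hxy : x < y) (hyz : y ≤ z) (ρ : Finset A) :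
    colInsert y (colInsert x (colInsert z ρ)) = colInsert y (colInsert z (colInsert x ρ)) := by
  -- If no letter of `ρ` lies in `[x, z)`, the effect of `z` is erased on both sides: by `x` on the
  -- left, by `y` on the right. Otherwise `x` replaces a letter below `z`, and `x` and `z` commute.
  by_cases h : ∀ t ∈ ρ, x ≤ t → z ≤ t
  · rw [colInsert_colInsert_of_gap (hxy.le.trans hyz) h, colInsert_colInsert_of_gap hyz]
    intro t ht hyt
    rw [mem_colInsert] at ht
    grind
  · congr 1
    push Not at h
    obtain ⟨s, hs, hxs, hsz⟩ := h
    rcases colInsert_cases x ρ with ⟨h, e⟩ | ⟨p, hp, hxp, hm, e⟩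
    · exact absurd (h s hs) (not_lt.2 hxs)
    have := hm s hs hxs
    ext w
    simp only [mem_colInsert]
    grind

theorem card_colRight {c : A} {γ : Finset A} (h : Frank γ c) :
    (colRight γ c).card = γ.card := by
  obtain ⟨b, hb, hbc, -, e⟩ := colRight_of_frank h
  rw [e, Finset.card_insert_of_notMem (fun hm => h.2 (Finset.mem_of_mem_erase hm)),
    Finset.card_erase_add_one hb]

end Columns

/-! ### A monotone potential -/

section Potential

variable {A : Type*} [LinearOrder A] [Fintype A]

/-- A potential on the columns, which left insertion increases and the frank right action
decreases. -/
def colPotential (γ : Finset A) : ℕ := ∑ x ∈ γ, (Finset.univ.filter (fun t => x ≤ t)).card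

theorem card_filter_le_pos (x : A) : 0 < (Finset.univ.filter (fun t => x ≤ t)).card :=
  Finset.card_pos.2 ⟨x, by simp⟩

theorem card_filter_le_lt {x y : A} (h : x < y) :
    (Finset.univ.filter (fun t => y ≤ t)).card < (Finset.univ.filter (fun t => x ≤ t)).card := by
  apply Finset.card_lt_card
  rw [Finset.ssubset_iff_of_subset]
  · exact ⟨x, by simp, by simpa using h⟩
  · intro t ht
    simp only [Finset.mem_filter, Finset.mem_univ, true_and] at *
    order

theorem colPotential_exchange {x y : A} {γ : Finset A} (hx : x ∉ γ) (hy : y ∈ γ) (hxy : x < y) :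
    colPotential γ < colPotential (insert x (γ.erase y)) := by
  unfold colPotential
  rw [Finset.sum_insert (fun h => hx (Finset.mem_of_mem_erase h)), ← Finset.add_sum_erase γ _ hy]
  have := card_filter_le_lt hxy
  omega

theorem colPotential_lt_colInsert {x : A} {γ : Finset A} (h : x ∉ γ) :
    colPotential γ < colPotential (colInsert x γ) := by
  rcases colInsert_cases x γ with ⟨-, e⟩ | ⟨y, hy, hxy, -, e⟩
  · rw [e, colPotential, colPotential, Finset.sum_insert h]
    have := card_filter_le_pos x
    omega
  · rw [e]
    exact colPotential_exchange h hy (lt_of_le_of_ne hxy (fun he => h (he ▸ hy)))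

theorem colPotential_le_colInsert (x : A) (γ : Finset A) :
    colPotential γ ≤ colPotential (colInsert x γ) := by
  by_cases h : x ∈ γ
  · rw [colInsert_of_mem h]
  · exact (colPotential_lt_colInsert h).le

theorem colPotential_colRight_lt {c : A} {γ : Finset A} (h : Frank γ c) :
    colPotential (colRight γ c) < colPotential γ := by
  obtain ⟨b, hb, hbc, -, e⟩ := colRight_of_frank h
  have hc : c ∈ colRight γ c := mem_colRight.2 (Or.inl rfl)
  have hb' : b ∉ colRight γ c := by rw [e]; simp [hbc.ne]
  have := colPotential_exchange hb' hc hbc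
  rwa [show insert b ((colRight γ c).erase c) = γ by
    rw [e, Finset.erase_insert (fun hm => h.2 (Finset.mem_of_mem_erase hm)),
      Finset.insert_erase hb]] at this

end Potential

/-! ### Plactic relations and column words in the stylic monoid -/

section StylicMonoid

variable {A : Type*} [LinearOrder A]

/-- The class of a letter in the stylic monoid. -/
def letterClass (a : A) : Styl A := stylMk A (FreeMonoid.of a)

/-- The class of a word, given as a list of letters, in the stylic monoid. -/
def wordClass (l : List A) : Styl A := stylMk A (FreeMonoid.ofList l)

/-- The class of a column in the stylic monoid. -/
def colClass (γ : Finset A) : Styl A := stylMk A (colWord γ)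

/-- The left action of the stylic monoid on the columns. -/
def stylAct (m : Styl A) (γ : Finset A) : Finset A := m.1 γ

/-- The image of the empty column. -/
def shape (m : Styl A) : Finset A := stylAct m ∅

theorem wordClass_nil : wordClass ([] : List A) = 1 := map_one _

theorem wordClass_cons (a : A) (l : List A) :
    wordClass (a :: l) = letterClass a * wordClass l := by
  simp [wordClass, letterClass, FreeMonoid.ofList_cons]

theorem wordClass_append (l l' : List A) :
    wordClass (l ++ l') = wordClass l * wordClass l' := by
  simp [wordClass, FreeMonoid.ofList_append]

theorem exists_wordClass_eq (m : Styl A) : ∃ l, wordClass l = m := by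
  obtain ⟨w, rfl⟩ := (leftAction A).mrangeRestrict_surjective m
  exact ⟨FreeMonoid.toList w, rfl⟩

theorem stylAct_one (γ : Finset A) : stylAct 1 γ = γ := rfl

theorem stylAct_mul (m m' : Styl A) (γ : Finset A) :
    stylAct (m * m') γ = stylAct m (stylAct m' γ) := rfl

theorem stylAct_letterClass (a : A) (γ : Finset A) :
    stylAct (letterClass a) γ = colInsert a γ :=
  congrFun (FreeMonoid.lift_eval_of (M := Function.End (Finset A)) colInsert a) γ

theorem styl_ext {m m' : Styl A} (h : ∀ γ, stylAct m γ = stylAct m' γ) : m = m' :=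
  Subtype.ext (funext h)

@[elab_as_elim]
theorem styl_induction {P : Styl A → Prop} (one : P 1)
    (letter_mul : ∀ a m, P m → P (letterClass a * m)) (m : Styl A) : P m := by
  obtain ⟨l, rfl⟩ := exists_wordClass_eq m
  induction l with
  | nil => exact one
  | cons a l ih => rw [wordClass_cons]; exact letter_mul a _ ih

theorem stylAct_mono (m : Styl A) {γ ρ : Finset A} (h : γ ⊆ ρ) : stylAct m γ ⊆ stylAct m ρ := by
  induction m using styl_induction with
  | one => exact h
  | letter_mul a m ih =>
    rw [stylAct_mul, stylAct_mul, stylAct_letterClass, stylAct_letterClass]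
    exact colInsert_mono a ih

theorem card_le_card_stylAct (m : Styl A) (γ : Finset A) : γ.card ≤ (stylAct m γ).card := by
  induction m using styl_induction with
  | one => exact le_rfl
  | letter_mul a m ih =>
    rw [stylAct_mul, stylAct_letterClass]
    exact ih.trans (card_le_card_colInsert _ _)

theorem shape_letter_mul (a : A) (m : Styl A) :
    shape (letterClass a * m) = colInsert a (shape m) := by
  rw [shape, stylAct_mul, stylAct_letterClass, shape]

/-- By monotonicity the shape of `m` lies in every column in the image of `m`, so inserting `a`
there changes nothing. -/
theorem letter_mul_of_mem_shape {a : A} {m : Styl A} (h : a ∈ shape m) :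
    letterClass a * m = m := by
  apply styl_ext
  intro γ
  rw [stylAct_mul, stylAct_letterClass]
  exact colInsert_of_mem (stylAct_mono m (Finset.empty_subset γ) h)

theorem letter_mul_self (a : A) : letterClass a * letterClass a = letterClass a := by
  apply styl_ext
  intro γ
  simp only [stylAct_mul, stylAct_letterClass, colInsert_idem]

theorem letter_knuth_left {x y z : A} (hxy : x ≤ y) (hyz : y < z) :
    letterClass x * letterClass z * letterClass y =
      letterClass z * letterClass x * letterClass y := by
  apply styl_ext
  intro γ
  simp only [stylAct_mul, stylAct_letterClass, colInsert_knuth_left hxy hyz]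

theorem letter_knuth_right {x y z : A} (hxy : x < y) (hyz : y ≤ z) :
    letterClass y * letterClass x * letterClass z =
      letterClass y * letterClass z * letterClass x := by
  apply styl_ext
  intro γ
  simp only [stylAct_mul, stylAct_letterClass, colInsert_knuth_right hxy hyz]

/-- A letter moves to the left through the smaller letters of a decreasing word. -/
theorem letter_mul_word_mul_letter {b c : A} (hbc : b ≤ c) {l : List A}
    (hl : (b :: l).Pairwise (· > ·)) :
    letterClass b * wordClass l * letterClass c =
      letterClass b * letterClass c * wordClass l := by
  induction l generalizing b with
  | nil => simp [wordClass_nil]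
  | cons g l ih =>
    rw [List.pairwise_cons] at hl
    have hg : g < b := hl.1 g (by simp)
    have := ih (hg.le.trans hbc) hl.2
    rw [wordClass_cons, mul_assoc, this, ← mul_assoc, ← mul_assoc, letter_knuth_right hg hbc,
      mul_assoc _ (letterClass g)]

/-- A letter moves to the left through the larger letters of a decreasing word, if a letter that is
larger than it follows. -/
theorem word_mul_letter_mul_letter {b c : A} (hbc : b < c) {l : List A}
    (hl : (l ++ [c]).Pairwise (· > ·)) :
    wordClass l * letterClass b * letterClass c =
      letterClass b * wordClass (l ++ [c]) := by
  induction l with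
  | nil => simp [wordClass_nil, wordClass_cons]
  | cons p l ih =>
    rw [List.cons_append, List.pairwise_cons] at hl
    have hbl : ∀ y ∈ l ++ [c], b < y := by
      intro y hy
      rcases List.mem_append.1 hy with hy | hy
      · exact hbc.trans ((List.pairwise_append.1 hl.2).2.2 y hy c (by simp))
      · rw [List.mem_singleton.1 hy]; exact hbc
    rw [wordClass_cons, mul_assoc, mul_assoc, ← mul_assoc (wordClass l), ih hl.2,
      List.cons_append, wordClass_cons]
    obtain ⟨y, t, hy⟩ : ∃ y t, l ++ [c] = y :: t := List.exists_cons_of_ne_nil (by simp)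
    rw [hy] at hbl hl ⊢
    rw [wordClass_cons]
    have := letter_knuth_left (hbl y (by simp)).le (hl.1 y (by simp))
    simp only [← mul_assoc]
    rw [this]

theorem colClass_eq_wordClass {l : List A} (hl : l.Pairwise (· > ·)) :
    colClass l.toFinset = wordClass l := by
  have h : l.toFinset.sort (fun a b => b ≤ a) = l :=
    (List.toFinset_sort _ (hl.imp (fun h => h.ne'))).2 (hl.imp (fun h => le_of_lt h))
  rw [colClass, colWord, h, wordClass]

theorem exists_decreasing_list (γ : Finset A) :
    ∃ l : List A, l.Pairwise (· > ·) ∧ l.toFinset = γ :=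
  ⟨γ.sort (· ≥ ·), γ.sortedGT_sort.pairwise, Finset.sort_toFinset _ _⟩

theorem shape_colClass (γ : Finset A) : shape (colClass γ) = γ := by
  obtain ⟨l, hl, rfl⟩ := exists_decreasing_list γ
  rw [colClass_eq_wordClass hl]
  induction l with
  | nil => rfl
  | cons a l ih =>
    rw [List.pairwise_cons] at hl
    rw [wordClass_cons, shape_letter_mul, ih hl.2, List.toFinset_cons]
    ext w
    rw [mem_colInsert, Finset.mem_insert]
    have := hl.1 w
    simp only [List.mem_toFinset] at *
    grind

/-- The letter moves left through the smaller letters to its own copy and merges with it. -/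
theorem colClass_mul_letter_of_mem {a : A} {γ : Finset A} (h : a ∈ γ) :
    colClass γ * letterClass a = colClass γ := by
  obtain ⟨l, hl, rfl⟩ := exists_decreasing_list γ
  rw [colClass_eq_wordClass hl]
  obtain ⟨l₁, l₂, rfl⟩ := List.append_of_mem (List.mem_toFinset.1 h)
  have := letter_mul_word_mul_letter le_rfl (List.pairwise_append.1 hl).2.1
  rw [wordClass_append, wordClass_cons, mul_assoc, this, letter_mul_self]

/-- With `γ` written as `l₁ b l₂`, the letter `c` moves left until it follows `b`, and then `b`
moves out through `l₁`. Left insertion of the bumped letter `b` undoes the replacement. -/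
theorem colClass_mul_letter_of_frank {c : A} {γ : Finset A} (h : Frank γ c) :
    ∃ b, colClass γ * letterClass c = letterClass b * colClass (colRight γ c) ∧
      colInsert b (colRight γ c) = γ := by
  obtain ⟨b, hb, hbc, hmax, e⟩ := colRight_of_frank h
  refine ⟨b, ?_, ?_⟩
  · obtain ⟨l, hl, rfl⟩ := exists_decreasing_list γ
    obtain ⟨l₁, l₂, rfl⟩ := List.append_of_mem (List.mem_toFinset.1 hb)
    have hp := List.pairwise_append.1 hl
    have hp2 := List.pairwise_cons.1 hp.2.1
    have hc := h.2
    have hl₁ : ∀ x ∈ l₁, c < x := by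
      intro x hx
      by_contra hcx
      exact (hmax x (by simp [hx]) (not_lt.1 hcx)).not_gt (hp.2.2 x hx b (by simp))
    have e2 : colRight (l₁ ++ b :: l₂).toFinset c = (l₁ ++ c :: l₂).toFinset := by
      rw [e]
      ext w
      have := hp.2.2 w
      have := hp2.1 w
      simp only [Finset.mem_insert, Finset.mem_erase, List.mem_toFinset, List.mem_append,
        List.mem_cons] at *
      grind
    have hl' : (l₁ ++ c :: l₂).Pairwise (· > ·) := by
      refine List.pairwise_append.2 ⟨hp.1, List.pairwise_cons.2
        ⟨fun x hx => (hp2.1 x hx).trans hbc, hp2.2⟩, fun x hx y hy => ?_⟩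
      rcases List.mem_cons.1 hy with rfl | hy
      · exact hl₁ x hx
      · exact hp.2.2 x hx y (by simp [hy])
    have hl'' : (l₁ ++ [c]).Pairwise (· > ·) := by
      rw [List.append_cons] at hl'
      exact (List.pairwise_append.1 hl').1
    rw [e2, colClass_eq_wordClass hl, colClass_eq_wordClass hl', wordClass_append, wordClass_cons,
      mul_assoc, letter_mul_word_mul_letter hbc.le hp.2.1, ← mul_assoc, ← mul_assoc,
      word_mul_letter_mul_letter hbc hl'', mul_assoc, ← wordClass_append, List.append_assoc,
      List.singleton_append]
  · rw [e]
    have hc := h.2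
    ext w
    rw [mem_colInsert]
    have := hmax w
    simp only [Finset.mem_insert, Finset.mem_erase]
    grind

end StylicMonoid

/-! ### Annihilation by the products of `1 - a` -/

section StylicAlgebra

variable {A : Type*} [LinearOrder A]

/-- The class of a stylic element in the stylic algebra. -/
def algElt (m : Styl A) : StylAlgebra A := MonoidAlgebra.of ℤ (Styl A) m

theorem algElt_one : algElt (1 : Styl A) = 1 := map_one _

theorem algElt_mul (m m' : Styl A) : algElt (m * m') = algElt m * algElt m' := map_mul _ _ _

/-- The product of the `1 - a`, for `a` in a list of letters. -/
def oneSubProd (l : List A) : StylAlgebra A := (l.map (fun a => 1 - stylLetter a)).prod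

/-- The product of the `1 - a`, `a ∉ γ`, in increasing order. -/
def complProd [Fintype A] (γ : Finset A) : StylAlgebra A :=
  oneSubProd (γᶜ.sort (fun a b => a ≤ b))

theorem stylLetter_eq (a : A) : stylLetter a = algElt (letterClass a) := rfl

theorem oneSubProd_cons (a : A) (l : List A) :
    oneSubProd (a :: l) = (1 - stylLetter a) * oneSubProd l := by
  simp [oneSubProd]

theorem prod_map_stylLetter (l : List A) :
    (l.map (fun a => stylLetter a)).prod = algElt (wordClass l) := by
  induction l with
  | nil => rw [wordClass_nil, algElt_one, List.map_nil, List.prod_nil]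
  | cons a l ih => rw [List.map_cons, List.prod_cons, ih, wordClass_cons, stylLetter_eq, algElt_mul]

theorem colIdem_eq [Fintype A] (γ : Finset A) :
    colIdem γ = complProd γ * algElt (colClass γ) := by
  rw [colIdem, prod_map_stylLetter]
  rfl

/-- The letters of a list not containing `a` preserve the span of the elements whose shape
contains `a`, provided they are larger. -/
theorem oneSubProd_mul_mem_span {a : A} {l : List A} (hl : ∀ x ∈ l, a < x) {m : Styl A}
    (hm : a ∈ shape m) :
    oneSubProd l * algElt m ∈ Submodule.span ℤ (algElt '' {m : Styl A | a ∈ shape m}) := by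
  induction l with
  | nil => exact Submodule.subset_span ⟨m, hm, by simp [oneSubProd]⟩
  | cons x l ih =>
    rw [oneSubProd_cons, mul_assoc]
    have h := ih (fun y hy => hl y (by simp [hy]))
    generalize oneSubProd l * algElt m = f at h
    rw [sub_mul, one_mul]
    refine Submodule.sub_mem _ h ?_
    clear ih
    induction h using Submodule.span_induction with
    | mem f hf =>
      obtain ⟨m', hm', rfl⟩ := hf
      refine Submodule.subset_span ⟨letterClass x * m', ?_, by rw [stylLetter_eq, algElt_mul]⟩
      have := hl x (by simp)
      rw [Set.mem_ofPred_eq, shape_letter_mul, mem_colInsert]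
      exact Or.inr ⟨hm', Or.inl this⟩
    | zero => simp
    | add f g _ _ hf hg => rw [mul_add]; exact Submodule.add_mem _ hf hg
    | smul c f _ hf => rw [mul_smul_comm]; exact Submodule.smul_mem _ c hf

theorem oneSub_mul_eq_zero {a : A} {f : StylAlgebra A}
    (h : f ∈ Submodule.span ℤ (algElt '' {m : Styl A | a ∈ shape m})) :
    (1 - stylLetter a) * f = 0 := by
  induction h using Submodule.span_induction with
  | mem f hf =>
    obtain ⟨m, hm, rfl⟩ := hf
    rw [sub_mul, one_mul, stylLetter_eq, ← algElt_mul, letter_mul_of_mem_shape hm, sub_self]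
  | zero => simp
  | add f g _ _ hf hg => rw [mul_add, hf, hg, add_zero]
  | smul c f _ hf => rw [mul_smul_comm, hf, smul_zero]

/-- The factors to the right of `1 - a` involve larger letters, whose insertion keeps `a` in the
shape; then `1 - a` kills the result. -/
theorem complProd_mul_eq_zero [Fintype A] {γ : Finset A} {m : Styl A} {a : A} (ha : a ∉ γ)
    (hm : a ∈ shape m) : complProd γ * algElt m = 0 := by
  obtain ⟨l₁, l₂, h⟩ := List.append_of_mem
    ((Finset.mem_sort (fun a b : A => a ≤ b)).2 (Finset.mem_compl.2 ha))
  have hs : (γᶜ.sort (fun a b => a ≤ b)).Pairwise (· < ·) := γᶜ.sortedLT_sort.pairwise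
  rw [h] at hs
  have hl := (List.pairwise_cons.1 (List.pairwise_append.1 hs).2.1).1
  have : oneSubProd (l₁ ++ a :: l₂) = oneSubProd l₁ * oneSubProd (a :: l₂) := by
    simp [oneSubProd]
  rw [complProd, h, this, oneSubProd_cons, mul_assoc, mul_assoc,
    oneSub_mul_eq_zero (oneSubProd_mul_mem_span hl hm), mul_zero]

end StylicAlgebra

/-! ### Classes of paths -/

section Paths

variable {A : Type*} [LinearOrder A]

/-- The class of `γ u`, where `u` is the label of a path that starts from `γ`. -/
def pathClass {γ δ : QVertex A} (p : Quiver.Path γ δ) : Styl A :=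
  stylMk A (colWord γ.col * pathLabel p)

theorem pathClass_nil (γ : QVertex A) : pathClass (Quiver.Path.nil : Quiver.Path γ γ) =
    colClass γ.col := by
  rw [pathClass, pathLabel, mul_one, colClass]

theorem pathClass_cons {γ δ ε : QVertex A} (p : Quiver.Path γ δ) (e : δ ⟶ ε) :
    pathClass (p.cons e) = pathClass p * letterClass (edgeLetter e) := by
  rw [pathClass, pathLabel, ← mul_assoc, map_mul, pathClass, letterClass]

theorem card_target {γ δ : QVertex A} (p : Quiver.Path γ δ) : δ.col.card = γ.col.card := by
  induction p with
  | nil => rfl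
  | cons p e ih => rw [← e.target, card_colRight e.frank, ih]

/-- The element `v` is the product of the letters bumped along the path. This factorization exposes
the target column on the right, where further letters act. -/
theorem exists_pathClass_eq {γ δ : QVertex A} (p : Quiver.Path γ δ) :
    ∃ v : Styl A, pathClass p = v * colClass δ.col ∧ stylAct v δ.col = γ.col := by
  induction p with
  | nil => exact ⟨1, by rw [pathClass_nil, one_mul], stylAct_one _⟩
  | cons p e ih =>
    obtain ⟨v, hv, hs⟩ := ih
    obtain ⟨b, hb, hi⟩ := colClass_mul_letter_of_frank e.frank
    refine ⟨v * letterClass b, ?_, ?_⟩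
    · rw [pathClass_cons, hv, mul_assoc, edgeLetter, hb, e.target, mul_assoc]
    · rw [stylAct_mul, stylAct_letterClass, ← e.target, hi, hs]

theorem shape_pathClass {γ δ : QVertex A} (p : Quiver.Path γ δ) :
    shape (pathClass p) = γ.col := by
  obtain ⟨v, hv, hs⟩ := exists_pathClass_eq p
  have := shape_colClass δ.col
  rw [shape] at this
  rw [hv, shape, stylAct_mul, this, hs]

theorem pathClass_mul_letter_of_mem {γ δ : QVertex A} (p : Quiver.Path γ δ) {a : A}
    (ha : a ∈ δ.col) : pathClass p * letterClass a = pathClass p := by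
  obtain ⟨v, hv, -⟩ := exists_pathClass_eq p
  rw [hv, mul_assoc, colClass_mul_letter_of_mem ha]

theorem pathClass_mul_colClass {γ δ : QVertex A} (p : Quiver.Path γ δ) :
    pathClass p * colClass δ.col = pathClass p := by
  have : ∀ l : List A, (∀ a ∈ l, a ∈ δ.col) → pathClass p * wordClass l = pathClass p := by
    intro l hl
    induction l with
    | nil => rw [wordClass_nil, mul_one]
    | cons a l ih =>
      rw [wordClass_cons, ← mul_assoc, pathClass_mul_letter_of_mem p (hl a (by simp)),
        ih (fun x hx => hl x (by simp [hx]))]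
  exact this _ (fun a ha => (Finset.mem_sort _).1 ha)

/-- A letter smaller than those of the target of a path enlarges the shape. -/
theorem exists_mem_shape_of_lt {γ δ : QVertex A} (p : Quiver.Path γ δ) {a : A}
    (ha : ∀ x ∈ δ.col, a < x) : ∃ y ∉ γ.col, y ∈ shape (pathClass p * letterClass a) := by
  obtain ⟨v, hv, hs⟩ := exists_pathClass_eq p
  -- The letters of `δ` are inserted from the smallest up, all above `a`, so each leaves the earlier
  -- ones in place.
  have h1 : insert a δ.col ⊆ stylAct (colClass δ.col) {a} := by
    obtain ⟨l, hl, h⟩ := exists_decreasing_list δ.col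
    rw [← h] at ha ⊢
    rw [colClass_eq_wordClass hl]
    clear h hs
    induction l with
    | nil => simp [wordClass_nil, stylAct_one]
    | cons x l ih =>
      rw [List.pairwise_cons] at hl
      have ih := ih (fun y hy => ha y (by rw [List.toFinset_cons]; exact Finset.mem_insert_of_mem hy)) hl.2
      rw [wordClass_cons, stylAct_mul, stylAct_letterClass]
      intro w hw
      have hax := ha x (by simp)
      have := hl.1 w
      have hmem := @ih w
      rw [mem_colInsert]
      simp only [Finset.mem_insert, List.mem_toFinset, List.mem_cons] at *
      grind
  have h2 : shape (pathClass p * letterClass a) = stylAct v (stylAct (colClass δ.col) {a}) := by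
    rw [hv, shape, stylAct_mul, stylAct_mul, stylAct_letterClass,
      show colInsert a ∅ = {a} by ext w; simp [mem_colInsert]]
  -- The action of `v` does not decrease cardinality, so the shape has more letters than `δ`, hence
  -- than `γ`.
  by_contra! hcon
  have h3 : shape (pathClass p * letterClass a) ⊆ γ.col := fun y hy => by
    by_contra hy'
    exact hcon y hy' hy
  have h4 := Finset.card_le_card h3
  have h5 := card_le_card_stylAct v (stylAct (colClass δ.col) {a})
  have h6 := Finset.card_le_card h1
  rw [Finset.card_insert_of_notMem (fun h => lt_irrefl _ (ha a h)), card_target p] at h6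
  rw [h2] at h4
  omega

/-! ### Values of paths and absorption of idempotents -/

variable [Fintype A]

/-- The element `e_γ u` of the stylic algebra, where `u` is the label of a path starting
from `γ`. -/
def pathValue {γ δ : QVertex A} (p : Quiver.Path γ δ) : StylAlgebra A :=
  complProd γ.col * algElt (pathClass p)

/-- Right multiplication by a letter of the value of a path. -/
theorem pathValue_mul_letter {γ δ : QVertex A} (p : Quiver.Path γ δ) (a : A) :
    (a ∈ δ.col ∧ pathValue p * stylLetter a = pathValue p) ∨
    (a ∉ δ.col ∧ pathValue p * stylLetter a = 0) ∨
    (Frank δ.col a ∧ ∃ p' : Quiver.Path γ ⟨colRight δ.col a⟩,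
      pathValue p * stylLetter a = pathValue p') := by
  have key : pathValue p * stylLetter a = complProd γ.col * algElt (pathClass p * letterClass a) := by
    rw [pathValue, stylLetter_eq, mul_assoc, algElt_mul]
  by_cases h1 : a ∈ δ.col
  · exact Or.inl ⟨h1, by rw [key, pathClass_mul_letter_of_mem p h1, pathValue]⟩
  by_cases h2 : ∃ x ∈ δ.col, x ≤ a
  · refine Or.inr (Or.inr ⟨⟨h2, h1⟩, p.cons (QEdge.mk a ⟨h2, h1⟩ rfl), ?_⟩)
    rw [key, pathValue, pathClass_cons, edgeLetter]
  · push Not at h2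
    obtain ⟨y, hy, hy'⟩ := exists_mem_shape_of_lt p h2
    exact Or.inr (Or.inl ⟨h1, by rw [key, complProd_mul_eq_zero hy hy']⟩)

theorem pathValue_cons {γ δ ε : QVertex A} (p : Quiver.Path γ δ) (e : δ ⟶ ε) :
    pathValue (p.cons e) = pathValue p * stylLetter (edgeLetter e) := by
  rw [pathValue, pathValue, pathClass_cons, stylLetter_eq, mul_assoc, ← algElt_mul]

/-- The invariant `S` holds the letters already read: a later, smaller letter displaces only a
letter at most itself, so `S` survives. -/
theorem pathValue_mul_word {γ δ : QVertex A} (p : Quiver.Path γ δ) {l : List A}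
    (hl : l.Pairwise (· > ·)) {S : Finset A} (hS : S ⊆ δ.col) (hlS : ∀ x ∈ S, ∀ y ∈ l, y < x) :
    pathValue p * algElt (wordClass l) = 0 ∨
      ∃ (δ' : QVertex A) (p' : Quiver.Path γ δ'), pathValue p * algElt (wordClass l) = pathValue p' ∧
        colPotential δ'.col ≤ colPotential δ.col ∧ S ∪ l.toFinset ⊆ δ'.col := by
  induction l generalizing δ S with
  | nil => exact Or.inr ⟨δ, p, by rw [wordClass_nil, algElt_one, mul_one], le_rfl, by simpa using hS⟩
  | cons a l ih =>
    rw [List.pairwise_cons] at hl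
    rw [wordClass_cons, algElt_mul, ← mul_assoc, ← stylLetter_eq]
    have hS' : ∀ x ∈ insert a S, ∀ y ∈ l, y < x := by
      intro x hx y hy
      rcases Finset.mem_insert.1 hx with rfl | hx
      · exact hl.1 y hy
      · exact hlS x hx y (by simp [hy])
    have hU : S ∪ (a :: l).toFinset = insert a S ∪ l.toFinset := by
      ext; simp
    rw [hU]
    rcases pathValue_mul_letter p a with ⟨h, e⟩ | ⟨-, e⟩ | ⟨h, p', e⟩
    · rw [e]
      exact ih p hl.2 (Finset.insert_subset h hS) hS'
    · left; rw [e, zero_mul]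
    · rw [e]
      have hsub : insert a S ⊆ colRight δ.col a := by
        intro x hx
        rw [mem_colRight]
        rcases Finset.mem_insert.1 hx with rfl | hx
        · exact Or.inl rfl
        · exact Or.inr ⟨hS hx, Or.inl (hlS x hx a (by simp))⟩
      rcases ih p' hl.2 hsub hS' with h0 | ⟨δ', q, hq, hpot, hc⟩
      · exact Or.inl h0
      · exact Or.inr ⟨δ', q, hq, hpot.trans (colPotential_colRight_lt h).le, hc⟩

/-- A nonzero product would be the value of a path whose target contains `ε` and has its size, hence
equals `ε`; but the potential cannot rise. -/
theorem pathValue_mul_colClass_eq_zero {γ δ : QVertex A} (p : Quiver.Path γ δ) {ε : Finset A}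
    (hcard : ε.card = γ.col.card) (hpot : colPotential δ.col < colPotential ε) :
    pathValue p * algElt (colClass ε) = 0 := by
  obtain ⟨l, hl, rfl⟩ := exists_decreasing_list ε
  rw [colClass_eq_wordClass hl]
  rcases pathValue_mul_word p hl (Finset.empty_subset _) (by simp) with h | ⟨δ', p', -, h1, h2⟩
  · exact h
  · rw [Finset.empty_union] at h2
    have := Finset.eq_of_subset_of_card_le h2 (by rw [card_target p', hcard])
    rw [this] at hpot
    omega

/-- The span of the values of the paths from `γ` with a target of potential less than `k`. -/
def lowSpan (γ : QVertex A) (k : ℕ) : Submodule ℤ (StylAlgebra A) :=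
  Submodule.span ℤ {x | ∃ (δ : QVertex A) (p : Quiver.Path γ δ),
    colPotential δ.col < k ∧ pathValue p = x}

theorem mul_letter_mem_lowSpan {γ : QVertex A} {k : ℕ} {f : StylAlgebra A} (hf : f ∈ lowSpan γ k)
    (a : A) : f * stylLetter a ∈ lowSpan γ k := by
  induction hf using Submodule.span_induction with
  | mem f hf =>
    obtain ⟨δ, p, hp, rfl⟩ := hf
    rcases pathValue_mul_letter p a with ⟨-, e⟩ | ⟨-, e⟩ | ⟨h, p', e⟩
    · rw [e]; exact Submodule.subset_span ⟨δ, p, hp, rfl⟩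
    · rw [e]; exact Submodule.zero_mem _
    · rw [e]; exact Submodule.subset_span ⟨_, p', (colPotential_colRight_lt h).trans hp, rfl⟩
  | zero => simp
  | add f g _ _ hf hg => rw [add_mul]; exact Submodule.add_mem _ hf hg
  | smul c f _ hf => rw [smul_mul_assoc]; exact Submodule.smul_mem _ c hf

theorem mul_oneSubProd_mem_lowSpan {γ : QVertex A} {k : ℕ} (l : List A) {f : StylAlgebra A}
    (hf : f ∈ lowSpan γ k) : f * oneSubProd l ∈ lowSpan γ k := by
  induction l generalizing f with
  | nil => simpa [oneSubProd] using hf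
  | cons a l ih =>
    rw [oneSubProd_cons, ← mul_assoc, mul_sub, mul_one]
    exact ih (Submodule.sub_mem _ hf (mul_letter_mem_lowSpan hf a))

/-- A letter outside `δ` gives zero or a frank move, which lowers the potential; later factors stay
in `lowSpan`. -/
theorem pathValue_mul_oneSubProd {γ δ : QVertex A} (p : Quiver.Path γ δ) {l : List A}
    (hl : ∀ a ∈ l, a ∉ δ.col) :
    pathValue p * oneSubProd l - pathValue p ∈ lowSpan γ (colPotential δ.col) := by
  induction l with
  | nil => simp [oneSubProd]
  | cons a l ih =>
    have h : pathValue p * stylLetter a ∈ lowSpan γ (colPotential δ.col) := by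
      rcases pathValue_mul_letter p a with ⟨h, -⟩ | ⟨-, e⟩ | ⟨h, p', e⟩
      · exact absurd h (hl a (by simp))
      · rw [e]; exact Submodule.zero_mem _
      · rw [e]; exact Submodule.subset_span ⟨_, p', colPotential_colRight_lt h, rfl⟩
    have e : pathValue p * oneSubProd (a :: l) - pathValue p =
        (pathValue p * oneSubProd l - pathValue p) - pathValue p * stylLetter a * oneSubProd l := by
      rw [oneSubProd_cons]; noncomm_ring
    rw [e]
    exact Submodule.sub_mem _ (ih (fun x hx => hl x (by simp [hx])))
      (mul_oneSubProd_mem_lowSpan l h)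

theorem lowSpan_mul_colClass {γ : QVertex A} {ε : Finset A} (hcard : ε.card = γ.col.card)
    {f : StylAlgebra A} (hf : f ∈ lowSpan γ (colPotential ε)) : f * algElt (colClass ε) = 0 := by
  induction hf using Submodule.span_induction with
  | mem f hf =>
    obtain ⟨δ, p, hp, rfl⟩ := hf
    exact pathValue_mul_colClass_eq_zero p hcard hp
  | zero => simp
  | add f g _ _ hf hg => rw [add_mul, hf, hg, add_zero]
  | smul c f _ hf => rw [smul_mul_assoc, hf, smul_zero]

/-- The value of a path absorbs the idempotent of its target. -/
theorem pathValue_mul_colIdem {γ δ : QVertex A} (p : Quiver.Path γ δ) :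
    pathValue p * colIdem δ.col = pathValue p := by
  have h := lowSpan_mul_colClass (card_target p) (pathValue_mul_oneSubProd p
    (l := δ.colᶜ.sort (fun a b => a ≤ b)) (fun a ha => by simpa using ha))
  rw [sub_mul, sub_eq_zero] at h
  rw [colIdem_eq, complProd, ← mul_assoc, h, pathValue, mul_assoc, ← algElt_mul,
    pathClass_mul_colClass]

theorem pathImage_eq_pathValue {γ δ : QVertex A} (p : Quiver.Path γ δ) :
    pathImage p = pathValue p := by
  induction p with
  | nil => rw [pathImage, colIdem_eq, pathValue, pathClass_nil]
  | cons p e ih => rw [pathImage, ih, ← pathValue_cons, pathValue_mul_colIdem]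

end Paths

/-! ### Triangularity and the kernel -/

section Kernel

variable {A : Type*} [LinearOrder A]

theorem coeff_algElt (m m' : Styl A) : (algElt m).coeff m' = Finsupp.single m (1 : ℤ) m' := by
  rw [algElt, MonoidAlgebra.of_apply]
  rfl

theorem coeff_eq_zero_of_mem_span {S : Set (Styl A)} {m : Styl A} (hm : m ∉ S) {f : StylAlgebra A}
    (hf : f ∈ Submodule.span ℤ (algElt '' S)) : f.coeff m = 0 := by
  induction hf using Submodule.span_induction with
  | mem f hf =>
    obtain ⟨m', hm', rfl⟩ := hf
    rw [coeff_algElt, Finsupp.single_eq_of_ne]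
    rintro rfl
    exact hm hm'
  | zero => simp
  | add f g _ _ hf hg => simp [hf, hg]
  | smul c f _ hf => rw [MonoidAlgebra.coeff_smul, Finsupp.smul_apply, hf, smul_zero]

variable [Fintype A]

/-- In each term other than `m`, the first letter inserted is missing from the shape and strictly
raises its potential; later insertions never lower it. -/
theorem oneSubProd_mul_sub_mem_span {l : List A} {m : Styl A} (hl : ∀ a ∈ l, a ∉ shape m) :
    oneSubProd l * algElt m - algElt m ∈ Submodule.span ℤ
      (algElt '' {m' : Styl A | colPotential (shape m) < colPotential (shape m')}) := by
  induction l with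
  | nil => simp [oneSubProd]
  | cons a l ih =>
    have h := ih (fun x hx => hl x (by simp [hx]))
    have e : oneSubProd (a :: l) * algElt m - algElt m =
        (oneSubProd l * algElt m - algElt m) -
          stylLetter a * (oneSubProd l * algElt m - algElt m) - stylLetter a * algElt m := by
      rw [oneSubProd_cons]; noncomm_ring
    rw [e]
    refine Submodule.sub_mem _ (Submodule.sub_mem _ h ?_) ?_
    · generalize oneSubProd l * algElt m - algElt m = f at h
      clear ih e
      induction h using Submodule.span_induction with
      | mem f hf =>
        obtain ⟨m', hm', rfl⟩ := hf
        refine Submodule.subset_span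
          ⟨letterClass a * m', ?_, by rw [stylLetter_eq, algElt_mul]⟩
        rw [Set.mem_ofPred_eq, shape_letter_mul]
        exact lt_of_lt_of_le hm' (colPotential_le_colInsert _ _)
      | zero => simp
      | add f g _ _ hf hg => rw [mul_add]; exact Submodule.add_mem _ hf hg
      | smul c f _ hf => rw [mul_smul_comm]; exact Submodule.smul_mem _ c hf
    · refine Submodule.subset_span ⟨letterClass a * m, ?_, by rw [stylLetter_eq, algElt_mul]⟩
      rw [Set.mem_ofPred_eq, shape_letter_mul]
      exact colPotential_lt_colInsert (hl a (by simp))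

/-- The elements `m + (terms with shape of larger potential)` of the stylic algebra; they are linearly
independent. -/
def triangularElt (m : Styl A) : StylAlgebra A := complProd (shape m) * algElt m

theorem coeff_triangularElt {m m' : Styl A}
    (h : colPotential (shape m') ≤ colPotential (shape m)) :
    (triangularElt m).coeff m' = Finsupp.single m (1 : ℤ) m' := by
  have h1 := coeff_eq_zero_of_mem_span (m := m') (by simpa using h)
    (oneSubProd_mul_sub_mem_span (m := m) (l := (shape m)ᶜ.sort (fun a b => a ≤ b))
      (fun a ha => by simpa using ha))
  rw [MonoidAlgebra.coeff_sub, Finsupp.sub_apply, sub_eq_zero] at h1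
  rw [triangularElt, complProd, h1, coeff_algElt]

theorem linearCombination_triangularElt_eq_zero {y : Styl A →₀ ℤ}
    (h : Finsupp.linearCombination ℤ triangularElt y = 0) : y = 0 := by
  by_contra hy
  -- At an `m` of least potential, no other triangular element of the support contributes to the
  -- coefficient, which is therefore `y m`.
  obtain ⟨m, hm, hmin⟩ := Finset.exists_min_image y.support
    (fun m => colPotential (shape m)) (Finsupp.support_nonempty_iff.2 hy)
  have h1 : (Finsupp.linearCombination ℤ triangularElt y).coeff m = y m := by
    rw [Finsupp.linearCombination_apply, Finsupp.sum, MonoidAlgebra.coeff_sum,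
      Finsupp.finsetSum_apply, Finset.sum_eq_single m]
    · rw [MonoidAlgebra.coeff_smul, Finsupp.smul_apply, coeff_triangularElt le_rfl,
        Finsupp.single_eq_same, smul_eq_mul, mul_one]
    · intro m' hm' hne
      rw [MonoidAlgebra.coeff_smul, Finsupp.smul_apply, coeff_triangularElt (hmin m' hm'),
        Finsupp.single_eq_of_ne hne.symm, smul_zero]
    · exact fun hn => absurd hm hn
  rw [h] at h1
  exact Finsupp.mem_support_iff.1 hm h1.symm

theorem pathImage_eq_triangularElt {γ δ : QVertex A} (p : Quiver.Path γ δ) :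
    pathImage p = triangularElt (pathClass p) := by
  rw [pathImage_eq_pathValue, pathValue, triangularElt, shape_pathClass]

end Kernel

/-- An element of a free module is, modulo the differences of basis elements in the same fiber of
a map, determined by its image. -/
theorem Finsupp.mem_span_sub_of_mapDomain_eq_zero {ι κ : Type*} (f : ι → κ) {x : ι →₀ ℤ}
    (h : Finsupp.mapDomain f x = 0) :
    x ∈ Submodule.span ℤ {y : ι →₀ ℤ | ∃ i j, f i = f j ∧
      y = Finsupp.single i 1 - Finsupp.single j 1} := by
  have hs : ∀ i, ∃ j, f j = f i := fun i => ⟨i, rfl⟩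
  -- `s` picks one basis vector in each fiber. The default `0` is harmless, since only the values `s
  -- (f i)` matter. Their combination with coefficients `x` factors through `mapDomain f x`, so it
  -- vanishes and can be subtracted from `x`.
  let s : κ → ι →₀ ℤ := fun k =>
    open Classical in if h : ∃ j, f j = k then Finsupp.single h.choose 1 else 0
  have h1 : Finsupp.linearCombination ℤ (fun i => s (f i)) x = 0 := by
    have := Finsupp.linearCombination_mapDomain ℤ f (v' := s) x
    rw [h, map_zero] at this
    exact this.symm
  have h2 : x = Finsupp.linearCombination ℤ (fun i => Finsupp.single i (1 : ℤ) - s (f i)) x := by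
    conv_lhs => rw [← sub_zero x, ← h1]
    simp only [Finsupp.linearCombination_apply, smul_sub, Finsupp.sum_sub]
    simp
  rw [h2, Finsupp.linearCombination_apply]
  refine Submodule.sum_mem _ (fun i _ => Submodule.smul_mem _ _ (Submodule.subset_span ?_))
  have hi : ∃ j, f j = f i := ⟨i, rfl⟩
  exact ⟨i, hi.choose, hi.choose_spec.symm, by simp only [s, dif_pos hi]⟩

end

theorem proposition4 (A : Type*) [LinearOrder A] [Fintype A] :
    LinearMap.ker (quiverMap A) =
      Submodule.span ℤ {x : PathAlgebra A |
        ∃ (γ δ δ' : QVertex A) (p : Quiver.Path γ δ) (q : Quiver.Path γ δ'),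
          StylEquiv (colWord γ.col * pathLabel p) (colWord γ.col * pathLabel q) ∧
            x = pathElt p - pathElt q} := by
  apply le_antisymm
  · intro x hx
    have h : Finsupp.mapDomain (fun p : QPath A => pathClass p.2.2) x = 0 := by
      apply linearCombination_triangularElt_eq_zero
      rw [Finsupp.linearCombination_mapDomain]
      rw [LinearMap.mem_ker, quiverMap] at hx
      simpa only [pathImage_eq_triangularElt, Function.comp_def] using hx
    refine Submodule.span_mono ?_ (Finsupp.mem_span_sub_of_mapDomain_eq_zero _ h)
    rintro y ⟨⟨γ, δ, p⟩, ⟨γ', δ', q⟩, hpq, rfl⟩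
    -- The class of a path determines its start, namely its shape.
    obtain rfl : γ = γ' := by
      ext1
      rw [← shape_pathClass p, ← shape_pathClass q]
      exact congrArg shape hpq
    exact ⟨γ, δ, δ', p, q, hpq, rfl⟩
  · rw [Submodule.span_le]
    rintro x ⟨γ, δ, δ', p, q, h, rfl⟩
    have hpq : pathClass p = pathClass q := h
    rw [SetLike.mem_coe, LinearMap.mem_ker, map_sub, sub_eq_zero]
    simp [quiverMap, pathElt, pathImage_eq_triangularElt, hpq]
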